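/- Let $F$ be a field, and let $\mathrm{ch}(F)$ denote the additive order of the identity of $F$ (so $\mathrm{ch}(F)=\infty$ when $F$ has characteristic zero). For an $n\times n$ matrix $M=(m_{ij})$ write $\mathrm{per}(M)=\sum_{\sigma\in S_n}\prod_{i=1}^n m_{i,\sigma(i)}$ for its permanent. Theorem. Let $k,m,n$ be positive integers with $k>m(n-1)$ and put $K=(k-1)n-m\binom n2$. Let $A_1,\dots,A_n$ be subsets of $F$ of cardinality $k$, let $P_1,\dots,P_n\in F[x]$ have degree $m$, let $b_i=[x^m]P_i(x)$ be the leading coefficient of $P_i$, and let $B=(b_j^{\,i-1})_{1\le i,j\le n}$. (i) If $\mathrm{ch}(F)>K$ and $b_1,\dots,b_n$ are pairwise distinct, then $|S|\ge K+1$, where $$S=\Big\{\sum_{i=1}^n a_i:\ a_1\in A_1,\dots,a_n\in A_n,\ P_i(a_i)\ne P_j(a_j)\text{ if }i\ne j\Big\}.$$ (ii) If $\mathrm{ch}(F)>K-\binom n2$ and $\mathrm{per}(B)\ne0$, then $|T|\ge K-\binom n2+1$, where $$T=\Big\{\sum_{i=1}^n a_i:\ a_1\in A_1,\dots,a_n\in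 A_n,\ a_i\ne a_j\text{ and }P_i(a_i)\ne P_j(a_j)\text{ if }i\ne j\Big\}.$$ (iii) If $F=\mathbb C$, $q$ is a positive integer, $b_1,\dots,b_n$ are $q$th roots of unity (not necessarily primitive), and $n!$ does not belong to $$D(q)=\Big\{\sum_{p\mid q,\ p\text{ prime}}p\,x_p:\ x_p\in\{0,1,2,\dots\}\text{ for every prime divisor }p\text{ of }q\Big\},$$ then $\mathrm{per}(B)\ne0$. -/

import Mathlib

namespace RestrictedSumset

/-- The characteristic of a field `F` in the convention used here: the additive order of the
multiplicative identity, which is `⊤` (infinity) if the identity has infinite additive order. -/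
noncomputable def ch (F : Type*) [Field F] : ℕ∞ :=
  if addOrderOf (1 : F) = 0 then ⊤ else (addOrderOf (1 : F) : ℕ∞)

/-- `K = (k - 1) n - m * C(n, 2)`. For `k > m (n - 1)` and `k, n > 0` no subtraction truncates,
see `cast_K`. -/
def K (k m n : ℕ) : ℕ := (k - 1) * n - m * n.choose 2

/-- The integer `K - C(n, 2)`. For `k > m (n - 1)` and `k, m, n > 0` no subtraction truncates,
see `cast_K'`. -/
def K' (k m n : ℕ) : ℕ := K k m n - n.choose 2

/-- The set of all sums `a_1 + ... + a_n` with `a_i ∈ A_i` such that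
`P_i(a_i) ≠ P_j(a_j)` if `i ≠ j`. -/
def S {F : Type*} [Field F] {n : ℕ} (A : Fin n → Finset F) (P : Fin n → Polynomial F) : Set F :=
  {s | ∃ a : Fin n → F, (∀ i, a i ∈ A i) ∧
    (∀ i j, i ≠ j → (P i).eval (a i) ≠ (P j).eval (a j)) ∧ s = ∑ i, a i}

/-- The set of all sums `a_1 + ... + a_n` with `a_i ∈ A_i` such that
`a_i ≠ a_j` and `P_i(a_i) ≠ P_j(a_j)` if `i ≠ j`. -/
def T {F : Type*} [Field F] {n : ℕ} (A : Fin n → Finset F) (P : Fin n → Polynomial F) : Set F :=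
  {s | ∃ a : Fin n → F, (∀ i, a i ∈ A i) ∧
    (∀ i j, i ≠ j → a i ≠ a j ∧ (P i).eval (a i) ≠ (P j).eval (a j)) ∧ s = ∑ i, a i}

/-- The matrix with entry `b_j ^ (i - 1)` in row `i` and column `j`, where `1 ≤ i, j ≤ n`
(the indices in `Fin n` start at `0`, hence the exponent `i`). -/
def B {F : Type*} [Field F] {n : ℕ} (b : Fin n → F) : Matrix (Fin n) (Fin n) F :=
  Matrix.of fun i j => b j ^ (i : ℕ)

/-- The set of all sums `∑ p * x_p` over the prime divisors `p` of `q`, where the `x_p` are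
nonnegative integers. -/
def D (q : ℕ) : Set ℕ :=
  {s | ∃ x : ℕ → ℕ, s = ∑ p ∈ q.primeFactors, p * x p}

theorem two_mul_choose_two (n : ℕ) : n * (n - 1) = 2 * n.choose 2 := by
  rw [Nat.choose_two_right]
  exact (Nat.mul_div_cancel' (Nat.even_mul_pred_self n).two_dvd).symm

theorem two_mul_le {k m n : ℕ} (h : m * (n - 1) < k) :
    2 * (m * n.choose 2) ≤ (k - 1) * n := by
  have h1 : m * (n - 1) ≤ k - 1 := by omega
  calc 2 * (m * n.choose 2) = m * (n - 1) * n := by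
        rw [mul_left_comm, ← two_mul_choose_two]; ring
    _ ≤ (k - 1) * n := Nat.mul_le_mul_right n h1

theorem cast_K {k m n : ℕ} (hk : 0 < k) (h : m * (n - 1) < k) :
    (K k m n : ℤ) = ((k : ℤ) - 1) * n - m * (n.choose 2 : ℤ) := by
  have h2 := two_mul_le h
  have h3 : m * n.choose 2 ≤ (k - 1) * n := by omega
  rw [K, Nat.cast_sub h3]
  push_cast [Nat.cast_sub hk]
  ring

theorem cast_K' {k m n : ℕ} (hk : 0 < k) (hm : 0 < m) (h : m * (n - 1) < k) :
    (K' k m n : ℤ) = ((k : ℤ) - 1) * n - m * (n.choose 2 : ℤ) - (n.choose 2 : ℤ) := by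
  have h2 := two_mul_le h
  have h3 : n.choose 2 ≤ m * n.choose 2 := Nat.le_mul_of_pos_left _ hm
  have h4 : n.choose 2 ≤ K k m n := by unfold K; omega
  rw [K', Nat.cast_sub h4, cast_K hk h]

end RestrictedSumset

/-!
The two lower bounds come from the polynomial method. If a set of restricted sums had at most `N`
elements, then multiplying the polynomial `f` that encodes the restrictions by linear factors
`∑ xᵢ - c` would give a polynomial vanishing on the grid `A₁ × ⋯ × Aₙ`, against the combinatorial
Nullstellensatz as soon as `∏ xᵢ ^ (k - 1)` has a nonzero coefficient in `g (∑ xᵢ) ^ N`, where `g`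
is the leading form of `f` (`succ_le_ncard_restricted_sumset`).

For `S`, the leading form is the Vandermonde determinant in the `bᵢ xᵢ ^ m`. Expanding it, the
multinomial coefficients that occur agree up to a permutation of the exponents, and the coefficient
is this common value, a divisor of `K!`, times `det B`
(`coeff_vandermondeForm_mul_sum_X_pow`). For `T`, there is a second Vandermonde factor, in the `xᵢ`.
For a fixed term `σ` of the first one, the sum over the terms of the second is a determinant of
falling factorials of the numbers `k - 1 - m σᵢ`, hence again a Vandermonde determinant; it
contributes another sign of `σ`, so that the signs cancel and the permanent of `B` appears
(`coeff_vandermondeForm_mul_vandermondeForm_mul_sum_X_pow`). The integer in front of it satisfies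
`c ∏ (k - 1 - m i)! = ± K'! ∏_{i < j} m (j - i)`, and it does not vanish in `F` because the right
hand side does not, apart from two extremal families in which `c = ± 1`
(`vandermondeCoeff_cast_ne_zero`).

If the `bᵢ` are `q`-th roots of unity, then `per B` is a sum of `n!` such roots, and
its nonvanishing is the theorem of Lam and Leung that a vanishing sum of `q`-th roots of unity has a
number of terms which is a sum of prime divisors of `q` (`card_mem_D_of_sum_eq_zero`). It is proved
by splitting such a sum along cosets of the `q / p`-th roots of unity. If `p ^ 2 ∣ q`, the parts
vanish separately. If `q` is squarefree, all parts have the same sum, as `1 + ω + ⋯ + ω ^ (p - 1)`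
spans the relations between the `p`-th roots of unity over the smaller cyclotomic field. Either the
shortest part is contained in all the others, and induction applies to the differences; or
`le_or_sub_mul_le_card` shows that there are at least `(p₁ - 1) (p₂ - 1)` terms, where `p₁ < p₂` are
the smallest primes dividing `q`, and then their number is of the form `a p₁ + b p₂` by Sylvester's
theorem.
-/

namespace RestrictedSumset

open Finset

/-! ### Leading forms and the polynomial method -/

section LeadingForm

open MvPolynomial

variable {ι R : Type*} [CommRing R]

/-- `HasLeadingForm d F G` says that `F` has total degree at most `d` and that `G` is its
homogeneous component of degree `d`; the form `G` is allowed to vanish. -/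
structure HasLeadingForm (d : ℕ) (F G : MvPolynomial ι R) : Prop where
  isHomogeneous : G.IsHomogeneous d
  coeff_eq : ∀ e : ι →₀ ℕ, d ≤ e.degree → coeff e F = coeff e G

namespace HasLeadingForm

variable {d d₁ d₂ : ℕ} {F G F₁ F₂ G₁ G₂ : MvPolynomial ι R}

theorem of_isHomogeneous (h : F.IsHomogeneous d) : HasLeadingForm d F F := ⟨h, fun _ _ => rfl⟩

theorem coeff_eq_zero (h : HasLeadingForm d F G) {e : ι →₀ ℕ} (he : d < e.degree) :
    coeff e F = 0 := by
  rw [h.coeff_eq e he.le]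
  exact h.isHomogeneous.coeff_eq_zero he.ne'

theorem totalDegree_le (h : HasLeadingForm d F G) : F.totalDegree ≤ d := by
  refine Finset.sup_le fun e he => ?_
  by_contra! hlt
  exact mem_support_iff.1 he (h.coeff_eq_zero (by rwa [Finsupp.degree_apply]))

theorem sub (h₁ : HasLeadingForm d F₁ G₁) (h₂ : HasLeadingForm d F₂ G₂) :
    HasLeadingForm d (F₁ - F₂) (G₁ - G₂) where
  isHomogeneous := h₁.isHomogeneous.sub h₂.isHomogeneous
  coeff_eq e he := by simp [h₁.coeff_eq e he, h₂.coeff_eq e he]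

theorem coeff_mul_eq_zero {H E : MvPolynomial ι R}
    (hH : ∀ e : ι →₀ ℕ, d₁ ≤ e.degree → coeff e H = 0)
    (hE : ∀ e : ι →₀ ℕ, d₂ < e.degree → coeff e E = 0) {e : ι →₀ ℕ} (he : d₁ + d₂ ≤ e.degree) :
    coeff e (H * E) = 0 := by
  classical
  rw [coeff_mul]
  refine sum_eq_zero fun x hx => ?_
  have hdeg : x.1.degree + x.2.degree = e.degree := by
    rw [← mem_antidiagonal.1 hx, map_add]
  rcases le_or_gt d₁ x.1.degree with h | h
  · rw [hH _ h, zero_mul]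
  · rw [hE _ (by omega), mul_zero]

theorem mul (h₁ : HasLeadingForm d₁ F₁ G₁) (h₂ : HasLeadingForm d₂ F₂ G₂) :
    HasLeadingForm (d₁ + d₂) (F₁ * F₂) (G₁ * G₂) where
  isHomogeneous := h₁.isHomogeneous.mul h₂.isHomogeneous
  coeff_eq e he := by
    have hsplit : F₁ * F₂ - G₁ * G₂ = (F₁ - G₁) * F₂ + (F₂ - G₂) * G₁ := by ring
    rw [← sub_eq_zero, ← coeff_sub, hsplit, coeff_add,
      coeff_mul_eq_zero (fun e he => by simp [h₁.coeff_eq e he]) (fun e => h₂.coeff_eq_zero) he,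
      coeff_mul_eq_zero (fun e he => by simp [h₂.coeff_eq e he])
        (fun e he => h₁.isHomogeneous.coeff_eq_zero he.ne')
        (add_comm d₁ d₂ ▸ he), add_zero]

theorem prod {κ : Type*} (s : Finset κ) (d : κ → ℕ) (F G : κ → MvPolynomial ι R)
    (h : ∀ i ∈ s, HasLeadingForm (d i) (F i) (G i)) :
    HasLeadingForm (∑ i ∈ s, d i) (∏ i ∈ s, F i) (∏ i ∈ s, G i) := by
  classical
  induction s using Finset.induction_on with
  | empty => simpa using of_isHomogeneous (isHomogeneous_one ι R)
  | insert a s ha ih =>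
    rw [sum_insert ha, prod_insert ha, prod_insert ha]
    exact (h a (mem_insert_self a s)).mul (ih fun i hi => h i (mem_insert_of_mem hi))

theorem aeval_X (i : ι) {m : ℕ} {P : Polynomial R} (hP : P.natDegree ≤ m) :
    HasLeadingForm m (Polynomial.aeval (X i : MvPolynomial ι R) P)
      (monomial (Finsupp.single i m) (P.coeff m)) where
  isHomogeneous := isHomogeneous_monomial _ (by simp)
  coeff_eq e he := by
    classical
    rw [Polynomial.aeval_eq_sum_range' (Nat.lt_succ_of_le hP), coeff_sum, coeff_monomial]
    simp only [coeff_smul, coeff_X_pow, smul_eq_mul, mul_ite, mul_one, mul_zero]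
    rw [sum_range_succ, sum_eq_zero, zero_add]
    intro j hj
    rw [if_neg]
    rintro rfl
    simp at he hj
    omega

end HasLeadingForm

/-- The Alon–Nathanson–Ruzsa bound for restricted sumsets. If there were at most `N` sums, then
multiplying `f` by linear factors `∑ X i - c` that kill all of them would give a polynomial
vanishing on the grid without changing the coefficient in question. -/
theorem succ_le_ncard_restricted_sumset {F : Type*} [Field F] [Fintype ι]
    (A : ι → Finset F) {k d N : ℕ} (hk : 0 < k) (hA : ∀ i, #(A i) = k)
    {f g : MvPolynomial ι F} (hfg : HasLeadingForm d f g) (hN : d + N = Fintype.card ι * (k - 1))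
    (hcoeff : coeff (Finsupp.equivFunOnFinite.symm fun _ => k - 1) (g * (∑ i, X i) ^ N) ≠ 0) :
    N + 1 ≤ {s | ∃ a : ι → F, (∀ i, a i ∈ A i) ∧ eval a f ≠ 0 ∧ s = ∑ i, a i}.ncard := by
  classical
  set U : Set F := {s | ∃ a : ι → F, (∀ i, a i ∈ A i) ∧ eval a f ≠ 0 ∧ s = ∑ i, a i} with hU
  set t : ι →₀ ℕ := Finsupp.equivFunOnFinite.symm fun _ => k - 1 with ht
  have hfin : U.Finite := by
    refine ((Fintype.piFinset A).finite_toSet.image fun a => ∑ i, a i).subset ?_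
    rintro s ⟨a, ha, -, rfl⟩
    exact ⟨a, by simpa using ha, rfl⟩
  by_contra! hlt
  have hcard : #hfin.toFinset ≤ N := by
    rw [← Set.ncard_eq_toFinset_card _ hfin]
    omega
  have hL : (∑ i, X i : MvPolynomial ι F).IsHomogeneous 1 :=
    IsHomogeneous.sum _ _ _ fun i _ => isHomogeneous_X F i
  have hlin (c : F) : HasLeadingForm 1 ((∑ i, X i : MvPolynomial ι F) - C c) (∑ i, X i) := by
    refine ⟨hL, fun e he => ?_⟩
    have hne : (0 : ι →₀ ℕ) ≠ e := by
      rintro rfl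
      simp at he
    rw [coeff_sub, coeff_C, if_neg hne, sub_zero]
  have hprod := HasLeadingForm.prod hfin.toFinset (fun _ => 1)
    (fun c => (∑ i, X i : MvPolynomial ι F) - C c) (fun _ => ∑ i, X i) fun c _ => hlin c
  simp only [sum_const, smul_eq_mul, mul_one, prod_const] at hprod
  have hall := (hfg.mul hprod).mul (HasLeadingForm.of_isHomogeneous
    (hL.pow (N - #hfin.toFinset)))
  have hdeg : d + #hfin.toFinset + 1 * (N - #hfin.toFinset) = t.degree := by
    rw [Finsupp.degree_eq_sum]
    simp [ht]
    omega
  rw [hdeg, mul_assoc g, ← pow_add, Nat.add_sub_cancel' hcard] at hall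
  have hne : coeff t (f * (∏ c ∈ hfin.toFinset, ((∑ i, X i : MvPolynomial ι F) - C c)) *
      (∑ i, X i) ^ (N - #hfin.toFinset)) ≠ 0 := by
    rwa [hall.coeff_eq t le_rfl]
  obtain ⟨a, haA, ha⟩ := combinatorial_nullstellensatz_exists_eval_nonzero _ t hne
    (hall.totalDegree_le.antisymm (le_totalDegree (mem_support_iff.2 hne))) A
    (fun i => by simp [ht, hA]; omega)
  refine ha ?_
  by_cases hfa : eval a f = 0
  · simp [hfa]
  · have hmem : ∑ i, a i ∈ hfin.toFinset := by simpa [hU] using ⟨a, haA, hfa, rfl⟩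
    rw [map_mul, map_mul, map_prod, prod_eq_zero hmem (by simp)]
    simp

end LeadingForm

/-! ### Coefficients of Vandermonde products -/

section Coefficients

open MvPolynomial Equiv

theorem sum_fin_val (n : ℕ) : ∑ i : Fin n, (i : ℕ) = n.choose 2 := by
  rw [Fin.sum_univ_eq_sum_range (fun i => i) n, sum_range_id, Nat.choose_two_right]

theorem sum_card_Ioi (n : ℕ) : ∑ i : Fin n, #(Ioi i) = n.choose 2 := by
  rw [← sum_fin_val, ← Equiv.sum_comp Fin.revPerm]
  refine sum_congr rfl fun i _ => ?_
  rw [Fin.card_Ioi, Fin.revPerm_apply, Fin.val_rev]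
  omega

theorem sum_perm_val {n : ℕ} (σ : Perm (Fin n)) : ∑ i, (σ i : ℕ) = n.choose 2 := by
  rw [← sum_fin_val]
  exact Equiv.sum_comp σ fun i : Fin n => (i : ℕ)

theorem mul_val_le {n m k : ℕ} (hkmn : m * (n - 1) < k) (i : Fin n) : m * (i : ℕ) ≤ k - 1 := by
  have := Nat.mul_le_mul_left m (show (i : ℕ) ≤ n - 1 by omega)
  omega

/-- The coefficient of `∏ xᵢ ^ κᵢ` in `(∏ xᵢ ^ δᵢ) (∑ xᵢ) ^ N`, where `N = ∑ κᵢ - ∑ δᵢ`. -/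
def shiftedMultinomial {n : ℕ} (κ δ : Fin n → ℕ) : ℕ :=
  if ∀ i, δ i ≤ κ i then Nat.multinomial univ (fun i => κ i - δ i) else 0

theorem coeff_monomial_mul_sum_X_pow {R : Type*} [CommRing R] {n N : ℕ} {κ δ : Fin n → ℕ}
    (h : ∑ i, δ i + N = ∑ i, κ i) (c : R) :
    coeff (Finsupp.equivFunOnFinite.symm κ)
      (monomial (Finsupp.equivFunOnFinite.symm δ) c * (∑ i, X i) ^ N) =
      c * (shiftedMultinomial κ δ : R) := by
  rw [coeff_monomial_mul', shiftedMultinomial]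
  have hle : Finsupp.equivFunOnFinite.symm δ ≤ Finsupp.equivFunOnFinite.symm κ ↔
      ∀ i, δ i ≤ κ i := Iff.rfl
  by_cases hδ : ∀ i, δ i ≤ κ i
  · rw [if_pos (hle.2 hδ), if_pos hδ, coeff_sum_X_pow_of_fintype]
    have hsum : ∑ i, (κ i - δ i) = N := by
      have := sum_tsub_distrib univ (fun i (_ : i ∈ univ) => hδ i)
      omega
    rw [if_pos]
    · rw [Finsupp.multinomial_eq_of_support_subset (subset_univ _)]
      rfl
    · rw [Finsupp.sum_fintype _ _ (fun _ => rfl)]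
      exact hsum
  · rw [if_neg (mt hle.1 hδ), if_neg hδ]
    simp

theorem shiftedMultinomial_mul_prod_factorial {n N : ℕ} {κ α τ : Fin n → ℕ}
    (hα : ∀ i, α i ≤ κ i) (h : ∑ i, (α i + τ i) + N = ∑ i, κ i) :
    shiftedMultinomial κ (fun i => α i + τ i) * ∏ i, (κ i - α i).factorial =
      N.factorial * ∏ i, (κ i - α i).descFactorial (τ i) := by
  rw [shiftedMultinomial]
  by_cases hτ : ∀ i, α i + τ i ≤ κ i
  · have hsum : ∑ i, (κ i - (α i + τ i)) = N := by
      have := sum_tsub_distrib univ (fun i (_ : i ∈ univ) => hτ i)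
      omega
    have hfac (i : Fin n) : (κ i - α i).factorial =
        (κ i - (α i + τ i)).factorial * (κ i - α i).descFactorial (τ i) := by
      have := hτ i
      rw [← Nat.factorial_mul_descFactorial (show τ i ≤ κ i - α i by omega), Nat.sub_sub]
    rw [if_pos hτ, prod_congr rfl fun i _ => hfac i, prod_mul_distrib, ← mul_assoc,
      mul_comm (Nat.multinomial _ _), Nat.multinomial_spec, hsum]
  · rw [if_neg hτ]
    push Not at hτ
    obtain ⟨i, hi⟩ := hτ
    rw [zero_mul, prod_eq_zero (mem_univ i), mul_zero]
    rw [Nat.descFactorial_eq_zero_iff_lt]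
    have := hα i
    omega

/-- The Vandermonde product in the variables `bᵢ xᵢ ^ m`. -/
noncomputable def vandermondeForm {R : Type*} [CommRing R] {n : ℕ} (m : ℕ) (b : Fin n → R) :
    MvPolynomial (Fin n) R :=
  ∏ i, ∏ j ∈ Ioi i, (monomial (Finsupp.single j m) (b j) - monomial (Finsupp.single i m) (b i))

theorem vandermondeForm_eq_sum {R : Type*} [CommRing R] {n : ℕ} (m : ℕ) (b : Fin n → R) :
    vandermondeForm m b = ∑ σ : Perm (Fin n),
      monomial (Finsupp.equivFunOnFinite.symm fun i => m * (σ i : ℕ))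
        (((Perm.sign σ : ℤ) : R) * ∏ i, b i ^ (σ i : ℕ)) := by
  rw [vandermondeForm,
    ← Matrix.det_vandermonde fun i => (monomial (Finsupp.single i m) (b i) : MvPolynomial _ R),
    ← Matrix.det_transpose, Matrix.det_apply']
  refine sum_congr rfl fun σ _ => ?_
  have hmon : ∏ i, (Matrix.vandermonde fun i =>
      (monomial (Finsupp.single i m) (b i) : MvPolynomial _ R)).transpose (σ i) i =
      monomial (Finsupp.equivFunOnFinite.symm fun i => m * (σ i : ℕ))
        (∏ i, b i ^ (σ i : ℕ)) := by
    simp only [Matrix.transpose_apply, Matrix.vandermonde_apply, monomial_pow]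
    rw [← monomial_sum_prod]
    congr 1
    congr 1
    ext j
    simp [Finsupp.finsetSum_apply, Finsupp.single_apply, mul_comm]
  rw [hmon, ← C_mul_monomial]
  simp

theorem hasLeadingForm_prod_sub {R : Type*} [CommRing R] {n m : ℕ} (P : Fin n → Polynomial R)
    (hP : ∀ i, (P i).natDegree ≤ m) :
    HasLeadingForm (n.choose 2 * m)
      (∏ i, ∏ j ∈ Ioi i, (Polynomial.aeval (X j : MvPolynomial (Fin n) R) (P j) -
        Polynomial.aeval (X i : MvPolynomial (Fin n) R) (P i)))
      (vandermondeForm m fun i => (P i).coeff m) := by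
  have h := HasLeadingForm.prod univ _ _ _ fun i (_ : i ∈ univ) =>
    HasLeadingForm.prod (Ioi i) _ _ _ fun j (_ : j ∈ Ioi i) =>
      (HasLeadingForm.aeval_X j (hP j)).sub (HasLeadingForm.aeval_X i (hP i))
  simpa only [sum_const, smul_eq_mul, ← sum_mul, sum_card_Ioi, vandermondeForm] using h

theorem coeff_vandermondeForm_mul_sum_X_pow {R : Type*} [CommRing R] {n m k N : ℕ}
    (hkmn : m * (n - 1) < k) (hN : n.choose 2 * m + N = n * (k - 1)) (b : Fin n → R) :
    coeff (Finsupp.equivFunOnFinite.symm fun _ => k - 1)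
      (vandermondeForm m b * (∑ i, X i) ^ N) =
      (Nat.multinomial univ fun i : Fin n => k - 1 - m * (i : ℕ) : ℕ) *
        (Matrix.vandermonde b).det := by
  have hle := mul_val_le hkmn
  rw [vandermondeForm_eq_sum, sum_mul, coeff_sum, ← Matrix.det_transpose, Matrix.det_apply',
    mul_sum]
  refine sum_congr rfl fun σ _ => ?_
  rw [coeff_monomial_mul_sum_X_pow, shiftedMultinomial, if_pos fun i => hle (σ i), mul_comm]
  · simp only [Matrix.transpose_apply, Matrix.vandermonde_apply]
    congr 2
    rw [Nat.multinomial, Nat.multinomial,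
      Equiv.sum_comp σ fun i : Fin n => k - 1 - m * (i : ℕ),
      Equiv.prod_comp σ fun i : Fin n => (k - 1 - m * (i : ℕ)).factorial]
  · rw [← mul_sum, sum_perm_val]
    simpa [mul_comm m] using hN

/-- The coefficient of `∏ xᵢ ^ (k - 1)` in `(∏ xᵢ ^ (m σᵢ)) (∏_{i < j} (xⱼ - xᵢ)) (∑ xᵢ) ^ N`,
where `N` is such that the degrees match. -/
def vandermondeCoeff {n : ℕ} (k m : ℕ) (σ : Perm (Fin n)) : ℤ :=
  ∑ τ : Perm (Fin n), (Perm.sign τ : ℤ) *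
    shiftedMultinomial (fun _ => k - 1) (fun i => m * (σ i : ℕ) + (τ i : ℕ))

/-- The coefficient is evaluated by pulling out `∏ (k - 1 - m σᵢ)!`: what remains is the
determinant of falling factorials, that is, a Vandermonde determinant. -/
theorem vandermondeCoeff_mul_prod_factorial {n m k N : ℕ} (hkmn : m * (n - 1) < k)
    (hN : n.choose 2 * m + n.choose 2 + N = n * (k - 1)) (σ : Perm (Fin n)) :
    vandermondeCoeff k m σ * ∏ i : Fin n, ((k - 1 - m * (i : ℕ)).factorial : ℤ) =
      (Perm.sign σ : ℤ) * (N.factorial *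
        (Matrix.vandermonde fun i : Fin n => ((k - 1 - m * (i : ℕ) : ℕ) : ℤ)).det) := by
  have hle := mul_val_le hkmn
  have hperm : (Perm.sign σ : ℤ) *
      (Matrix.vandermonde fun i : Fin n => ((k - 1 - m * (i : ℕ) : ℕ) : ℤ)).det =
      (Matrix.vandermonde fun i : Fin n => ((k - 1 - m * (σ i : ℕ) : ℕ) : ℤ)).det := by
    have := Matrix.det_permute σ
      (Matrix.vandermonde fun i : Fin n => ((k - 1 - m * (i : ℕ) : ℕ) : ℤ))
    rw [Int.cast_id] at this
    rw [← this]
    rfl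
  rw [mul_left_comm, hperm, Matrix.det_eval_matrixOfPolynomials_eq_det_vandermonde _ _
    (fun i => descPochhammer_natDegree ℤ i) (fun i => monic_descPochhammer ℤ i),
    ← Matrix.det_transpose, Matrix.det_apply', vandermondeCoeff, sum_mul, mul_sum]
  refine sum_congr rfl fun τ _ => ?_
  have h := shiftedMultinomial_mul_prod_factorial (N := N) (κ := fun _ : Fin n => k - 1)
    (α := fun i => m * (σ i : ℕ)) (τ := fun i => (τ i : ℕ)) (fun i => hle (σ i)) (by
      rw [sum_add_distrib, ← mul_sum, sum_perm_val, sum_perm_val]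
      simpa [mul_comm m] using hN)
  rw [Equiv.prod_comp σ fun i : Fin n => (k - 1 - m * (i : ℕ)).factorial] at h
  simp only [Matrix.transpose_apply, Matrix.of_apply, descPochhammer_eval_eq_descFactorial]
  rw [mul_assoc, mul_left_comm (N.factorial : ℤ)]
  congr 1
  exact_mod_cast h

theorem vandermondeCoeff_eq_sign_mul {n m k N : ℕ} (hkmn : m * (n - 1) < k)
    (hN : n.choose 2 * m + n.choose 2 + N = n * (k - 1)) (σ : Perm (Fin n)) :
    vandermondeCoeff k m σ = (Perm.sign σ : ℤ) * vandermondeCoeff k m (1 : Perm (Fin n)) := by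
  have hpos : ∏ i : Fin n, ((k - 1 - m * (i : ℕ)).factorial : ℤ) ≠ 0 :=
    prod_ne_zero_iff.2 fun i _ => by positivity
  refine mul_right_cancel₀ hpos ?_
  rw [mul_assoc, vandermondeCoeff_mul_prod_factorial hkmn hN,
    vandermondeCoeff_mul_prod_factorial hkmn hN]
  simp

theorem coeff_vandermondeForm_mul_vandermondeForm_mul_sum_X_pow {F : Type*} [Field F]
    {n m k N : ℕ} (hkmn : m * (n - 1) < k)
    (hN : n.choose 2 * m + n.choose 2 + N = n * (k - 1)) (b : Fin n → F) :
    coeff (Finsupp.equivFunOnFinite.symm fun _ => k - 1)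
      (vandermondeForm m b * vandermondeForm 1 (fun _ => 1) * (∑ i, X i) ^ N) =
      (vandermondeCoeff k m (1 : Perm (Fin n)) : F) * (B b).permanent := by
  rw [vandermondeForm_eq_sum, vandermondeForm_eq_sum, sum_mul, sum_mul, coeff_sum,
    Matrix.permanent, mul_sum]
  refine sum_congr rfl fun σ _ => ?_
  have hτ (τ : Perm (Fin n)) : coeff (Finsupp.equivFunOnFinite.symm fun _ => k - 1)
      (monomial (Finsupp.equivFunOnFinite.symm fun i => m * (σ i : ℕ))
        (((Perm.sign σ : ℤ) : F) * ∏ i, b i ^ (σ i : ℕ)) *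
      monomial (Finsupp.equivFunOnFinite.symm fun i => 1 * (τ i : ℕ))
        (((Perm.sign τ : ℤ) : F) * ∏ i : Fin n, 1 ^ (τ i : ℕ)) * (∑ i, X i) ^ N) =
      (((Perm.sign σ : ℤ) : F) * ∏ i, b i ^ (σ i : ℕ)) *
        (((Perm.sign τ : ℤ) * shiftedMultinomial (fun _ => k - 1)
          (fun i => m * (σ i : ℕ) + (τ i : ℕ)) : ℤ) : F) := by
    have hadd : Finsupp.equivFunOnFinite.symm (fun i => m * (σ i : ℕ)) +
        Finsupp.equivFunOnFinite.symm (fun i => 1 * (τ i : ℕ)) =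
        Finsupp.equivFunOnFinite.symm (fun i => m * (σ i : ℕ) + (τ i : ℕ)) := by
      ext i
      simp
    rw [monomial_mul, hadd, coeff_monomial_mul_sum_X_pow]
    · push_cast
      simp only [one_pow, prod_const_one, mul_one]
      ring
    · rw [sum_add_distrib, ← mul_sum, sum_perm_val, sum_perm_val]
      simpa [mul_comm m] using hN
  have hsq : ((Perm.sign σ : ℤ) : F) * ((Perm.sign σ : ℤ) : F) = 1 := by
    rw [← Int.cast_mul, ← Units.val_mul, Int.units_mul_self]
    simp
  rw [mul_sum, sum_mul, coeff_sum, sum_congr rfl fun τ _ => hτ τ, ← mul_sum, ← Int.cast_sum,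
    ← vandermondeCoeff, vandermondeCoeff_eq_sign_mul hkmn hN, Int.cast_mul]
  simp only [B, Matrix.of_apply]
  linear_combination (∏ i, b i ^ (σ i : ℕ)) * (vandermondeCoeff k m (1 : Perm (Fin n)) : F) * hsq

end Coefficients

/-! ### Lower bounds for the restricted sumsets -/

section SumsetBounds

open MvPolynomial Equiv

theorem natCast_ne_zero_of_lt_ch {F : Type*} [Field F] {N j : ℕ} (hN : (N : ℕ∞) < ch F)
    (hj : 0 < j) (hjN : j ≤ N) : (j : F) ≠ 0 := by
  intro h0
  have hdvd : addOrderOf (1 : F) ∣ j := by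
    rw [addOrderOf_dvd_iff_nsmul_eq_zero, nsmul_one, h0]
  have hne : addOrderOf (1 : F) ≠ 0 := ne_zero_of_dvd_ne_zero hj.ne' hdvd
  rw [ch, if_neg hne, Nat.cast_lt] at hN
  exact absurd (Nat.le_of_dvd hj hdvd) (by omega)

theorem factorial_ne_zero_of_lt_ch {F : Type*} [Field F] {N : ℕ} (hN : (N : ℕ∞) < ch F) :
    (N.factorial : F) ≠ 0 := by
  rw [← prod_range_add_one_eq_factorial, Nat.cast_prod]
  refine prod_ne_zero_iff.2 fun j hj => natCast_ne_zero_of_lt_ch hN (Nat.succ_pos j) ?_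
  simpa using hj

theorem choose_mul_add_K {k m n : ℕ} (hkmn : m * (n - 1) < k) :
    n.choose 2 * m + K k m n = n * (k - 1) := by
  have := two_mul_le hkmn
  rw [K, mul_comm n, mul_comm _ m]
  omega

theorem choose_mul_add_choose_add_K' {k m n : ℕ} (hm : 0 < m) (hkmn : m * (n - 1) < k) :
    n.choose 2 * m + n.choose 2 + K' k m n = n * (k - 1) := by
  have h1 := two_mul_le hkmn
  have h2 : n.choose 2 ≤ m * n.choose 2 := Nat.le_mul_of_pos_left _ hm
  rw [K', K, mul_comm n, mul_comm _ m]
  omega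

theorem multinomial_cast_ne_zero {F : Type*} [Field F] {k m n : ℕ} (hkmn : m * (n - 1) < k)
    (hch : (K k m n : ℕ∞) < ch F) :
    ((Nat.multinomial univ fun i : Fin n => k - 1 - m * (i : ℕ) : ℕ) : F) ≠ 0 := by
  have hle := mul_val_le hkmn
  have hsum : ∑ i : Fin n, (k - 1 - m * (i : ℕ)) = K k m n := by
    have h1 := sum_tsub_distrib univ (fun i (_ : i ∈ univ) => hle i)
    rw [← mul_sum, sum_fin_val] at h1
    simpa [K, mul_comm n] using h1
  have h := Nat.multinomial_spec univ fun i : Fin n => k - 1 - m * (i : ℕ)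
  rw [hsum] at h
  refine right_ne_zero_of_mul (a := ((∏ i : Fin n, (k - 1 - m * (i : ℕ)).factorial : ℕ) : F)) ?_
  rw [← Nat.cast_mul, h]
  exact factorial_ne_zero_of_lt_ch hch

theorem det_vandermonde_arith {n m k : ℕ} (hkmn : m * (n - 1) < k) :
    (Matrix.vandermonde fun i : Fin n => ((k - 1 - m * (i : ℕ) : ℕ) : ℤ)).det =
      ∏ i : Fin n, ∏ j ∈ Ioi i, -((m : ℤ) * ((j - i : ℕ) : ℤ)) := by
  have hle := mul_val_le hkmn
  rw [Matrix.det_vandermonde]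
  refine prod_congr rfl fun i _ => prod_congr rfl fun j hj => ?_
  have hij : (i : ℕ) ≤ j := (mem_Ioi.1 hj).le
  rw [Nat.cast_sub (hle i), Nat.cast_sub (hle j), Nat.cast_sub hij]
  push_cast
  ring

/-- If `n = 2` and `k = m + 1`, or `m = 1` and `k = n`, then the coefficient is `±1`, although `m`
or some `j - i` may vanish in `F`. If `n = 1`, it is `1`. Otherwise `n - 1 ≤ K'`, and `m ≤ K'` or
`m = 1`, so that no factor of `K'! ∏ m (j - i)` vanishes in `F`. -/
theorem vandermondeCoeff_cast_ne_zero {F : Type*} [Field F] {k m n : ℕ} (hm : 0 < m) (hn : 0 < n)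
    (hkmn : m * (n - 1) < k) (hch : (K' k m n : ℕ∞) < ch F) :
    (vandermondeCoeff k m (1 : Perm (Fin n)) : F) ≠ 0 := by
  have hN := choose_mul_add_choose_add_K' hm hkmn
  have hmul := vandermondeCoeff_mul_prod_factorial hkmn hN (1 : Perm (Fin n))
  rw [det_vandermonde_arith hkmn, Perm.sign_one, Units.val_one, one_mul] at hmul
  have hunit : IsUnit (vandermondeCoeff k m (1 : Perm (Fin n))) →
      (vandermondeCoeff k m (1 : Perm (Fin n)) : F) ≠ 0 := fun h =>
    (h.map (Int.castRingHom F)).ne_zero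
  have hgeneral : (m = 1 ∨ m ≤ K' k m n) → n - 1 ≤ K' k m n →
      (vandermondeCoeff k m (1 : Perm (Fin n)) : F) ≠ 0 := by
    intro hmK hnK
    have hmF : (m : F) ≠ 0 := by
      rcases hmK with rfl | hmK
      · simp
      · exact natCast_ne_zero_of_lt_ch hch hm hmK
    refine left_ne_zero_of_mul
      (b := ((∏ i : Fin n, ((k - 1 - m * (i : ℕ)).factorial : ℤ) : ℤ) : F)) ?_
    rw [← Int.cast_mul, hmul]
    push_cast
    refine mul_ne_zero (factorial_ne_zero_of_lt_ch hch) (prod_ne_zero_iff.2 fun i _ =>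
      prod_ne_zero_iff.2 fun j hj => neg_ne_zero.2 (mul_ne_zero hmF ?_))
    have hij : i < j := mem_Ioi.1 hj
    exact natCast_ne_zero_of_lt_ch hch (by omega) (by omega)
  have hpos : ∏ i : Fin n, ((k - 1 - m * (i : ℕ)).factorial : ℤ) ≠ 0 :=
    prod_ne_zero_iff.2 fun i _ => by positivity
  obtain rfl | rfl | hn3 : n = 1 ∨ n = 2 ∨ 3 ≤ n := by omega
  · refine hunit ?_
    have hK : K' k m 1 = k - 1 := by simpa using hN
    rw [hK] at hmul
    have : (vandermondeCoeff k m (1 : Perm (Fin 1))) = 1 := by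
      refine mul_right_cancel₀ hpos ?_
      rw [hmul]
      simp
    rw [this]
    exact isUnit_one
  · have hK : m + 1 + K' k m 2 = 2 * (k - 1) := by simpa using hN
    rcases (show m + 1 ≤ k by omega).eq_or_lt with rfl | hk
    · refine hunit ?_
      have hK' : K' (m + 1) m 2 = m - 1 := by omega
      rw [hK'] at hmul
      have : (vandermondeCoeff (m + 1) m (1 : Perm (Fin 2))) = -1 := by
        refine mul_right_cancel₀ hpos ?_
        rw [hmul]
        have := Nat.mul_factorial_pred hm.ne'
        simp [Fin.prod_univ_two, show Ioi (0 : Fin 2) = {1} from rfl,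
          show Ioi (1 : Fin 2) = ∅ from rfl, ← this]
        ring
      rw [this]
      exact isUnit_one.neg
    · exact hgeneral (by omega) (by omega)
  · have hC := two_mul_choose_two n
    obtain ⟨l, rfl⟩ : ∃ l, n = l + 1 := ⟨n - 1, by omega⟩
    simp only [Nat.add_sub_cancel] at hC hkmn hgeneral
    obtain rfl | hm2 : m = 1 ∨ 2 ≤ m := by omega
    · rcases (show l + 1 ≤ k by omega).eq_or_lt with rfl | hk
      · refine hunit ?_
        have hK : K' (l + 1) 1 (l + 1) = 0 := by
          simp only [Nat.add_sub_cancel] at hN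
          omega
        have hsf : ∏ i : Fin (l + 1), ((l + 1 - 1 - 1 * (i : ℕ)).factorial : ℤ) =
            l.superFactorial := by
          rw [← Equiv.prod_comp Fin.revPerm, ← Nat.prod_range_succ_factorial,
            ← Fin.prod_univ_eq_prod_range, Nat.cast_prod]
          refine prod_congr rfl fun i _ => ?_
          rw [Fin.revPerm_apply, Fin.val_rev]
          congr 2
          omega
        have hdet := Matrix.det_vandermonde_id_eq_superFactorial (R := ℤ) l
        rw [Matrix.det_vandermonde] at hdet
        have hsign : vandermondeCoeff (l + 1) 1 (1 : Perm (Fin (l + 1))) =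
            ∏ i : Fin (l + 1), ∏ j ∈ Ioi i, -1 := by
          refine mul_right_cancel₀ hpos ?_
          rw [hmul, hK, hsf, ← hdet]
          simp only [← prod_mul_distrib, Nat.factorial_zero, Nat.cast_one, one_mul]
          refine prod_congr rfl fun i _ => prod_congr rfl fun j hj => ?_
          rw [Nat.cast_sub (show (i : ℕ) ≤ j from (mem_Ioi.1 hj).le), neg_one_mul]
        rw [hsign]
        simp only [prod_const, prod_pow_eq_pow_sum]
        exact isUnit_one.neg.pow _
      · refine hgeneral (Or.inl rfl) ?_
        obtain ⟨c, rfl⟩ := Nat.exists_eq_add_of_lt hk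
        simp only [Nat.add_sub_cancel] at hN
        nlinarith
    · obtain ⟨c, rfl⟩ := Nat.exists_eq_add_of_lt hkmn
      simp only [Nat.add_sub_cancel] at hN
      have hCl : l + 1 ≤ (l + 1).choose 2 := by nlinarith
      obtain ⟨r, rfl⟩ := Nat.exists_eq_add_of_le hm2
      have hKC : (r + 1) * (l + 1).choose 2 ≤ K' ((2 + r) * l + c + 1) (2 + r) (l + 1) := by
        nlinarith
      refine hgeneral (Or.inr ?_) ?_ <;> nlinarith

theorem prod_Ioi_sub_ne_zero_iff {F : Type*} [Field F] {n : ℕ} (v : Fin n → F) :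
    ∏ i, ∏ j ∈ Ioi i, (v j - v i) ≠ 0 ↔ ∀ i j, i ≠ j → v i ≠ v j := by
  rw [← Matrix.det_vandermonde, Matrix.det_vandermonde_ne_zero_iff]
  exact ⟨fun h i j hij hv => hij (h hv), fun h i j hv => by_contra fun hij => h i j hij hv⟩

theorem eval_prod_Ioi_sub {F : Type*} [Field F] {n : ℕ} (a : Fin n → F)
    (P : Fin n → Polynomial F) :
    eval a (∏ i, ∏ j ∈ Ioi i, (Polynomial.aeval (X j : MvPolynomial (Fin n) F) (P j) -
        Polynomial.aeval (X i : MvPolynomial (Fin n) F) (P i))) =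
      ∏ i, ∏ j ∈ Ioi i, ((P j).eval (a j) - (P i).eval (a i)) := by
  have h (i : Fin n) : eval a (Polynomial.aeval (X i : MvPolynomial (Fin n) F) (P i)) =
      (P i).eval (a i) := by
    rw [← MvPolynomial.coe_aeval_eq_eval, RingHom.coe_coe, ← Polynomial.aeval_algHom_apply]
    simp [Polynomial.aeval_def]
  simp [map_prod, h]

theorem succ_K_le_ncard_S {F : Type*} [Field F] {k m n : ℕ} (hk : 0 < k)
    (hkmn : m * (n - 1) < k) {A : Fin n → Finset F} {P : Fin n → Polynomial F}
    (hA : ∀ i, #(A i) = k) (hP : ∀ i, (P i).degree = (m : WithBot ℕ))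
    (hch : (K k m n : ℕ∞) < ch F) (hb : ∀ i j, i ≠ j → (P i).coeff m ≠ (P j).coeff m) :
    K k m n + 1 ≤ (S A P).ncard := by
  have hN := choose_mul_add_K hkmn
  refine (succ_le_ncard_restricted_sumset A hk hA (hasLeadingForm_prod_sub P fun i =>
    Polynomial.natDegree_le_of_degree_le (hP i).le) (by simpa using hN) ?_).trans_eq ?_
  · rw [coeff_vandermondeForm_mul_sum_X_pow hkmn hN]
    exact mul_ne_zero (multinomial_cast_ne_zero hkmn hch)
      (Matrix.det_vandermonde_ne_zero_iff.2 fun i j hij => by_contra fun h => hb i j h hij)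
  · simp only [eval_prod_Ioi_sub]
    simp only [prod_Ioi_sub_ne_zero_iff (fun i => _), S]

theorem succ_K'_le_ncard_T {F : Type*} [Field F] {k m n : ℕ} (hk : 0 < k) (hm : 0 < m)
    (hn : 0 < n) (hkmn : m * (n - 1) < k) {A : Fin n → Finset F} {P : Fin n → Polynomial F}
    (hA : ∀ i, #(A i) = k) (hP : ∀ i, (P i).degree = (m : WithBot ℕ))
    (hch : (K' k m n : ℕ∞) < ch F) (hB : (B fun i => (P i).coeff m).permanent ≠ 0) :
    K' k m n + 1 ≤ (T A P).ncard := by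
  have hN := choose_mul_add_choose_add_K' hm hkmn
  have hX := hasLeadingForm_prod_sub (fun _ : Fin n => (Polynomial.X : Polynomial F)) (m := 1)
    fun _ => Polynomial.natDegree_X_le
  simp only [Polynomial.coeff_X_one] at hX
  refine (succ_le_ncard_restricted_sumset A hk hA ((hasLeadingForm_prod_sub P fun i =>
    Polynomial.natDegree_le_of_degree_le (hP i).le).mul hX) (by simpa using hN) ?_).trans_eq ?_
  · rw [coeff_vandermondeForm_mul_vandermondeForm_mul_sum_X_pow hkmn hN]
    exact mul_ne_zero (vandermondeCoeff_cast_ne_zero hm hn hkmn hch) hB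
  · simp only [map_mul, eval_prod_Ioi_sub, mul_ne_zero_iff]
    simp only [prod_Ioi_sub_ne_zero_iff (fun i => _), Polynomial.eval_X]
    congr 1
    ext s
    refine exists_congr fun a => and_congr_right fun _ => and_congr_left fun _ => ?_
    exact ⟨fun h i j hij => ⟨h.2 i j hij, h.1 i j hij⟩,
      fun h => ⟨fun i j hij => (h i j hij).2, fun i j hij => (h i j hij).1⟩⟩

end SumsetBounds

/-! ### Linear relations between roots of unity -/

section Cyclotomic

open IntermediateField Polynomial

/-- The tower law for `ℚ ⊆ ℚ(η) ⊆ ℚ(η, ω)`. -/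
theorem totient_le_totient_mul_natDegree_minpoly {q r : ℕ} (hq : 0 < q) (hr : 0 < r)
    {η ω ζ : ℂ} (hη : IsPrimitiveRoot η r) (hζ : IsPrimitiveRoot ζ q) (hω : IsIntegral ℚ ω)
    (hmem : ζ ∈ ℚ⟮η⟯⟮ω⟯) :
    q.totient ≤ r.totient * (minpoly ℚ⟮η⟯ ω).natDegree := by
  have hηint : IsIntegral ℚ η := (hη.isIntegral hr).tower_top
  have hωint : IsIntegral ℚ⟮η⟯ ω := hω.tower_top
  have hfin₁ : FiniteDimensional ℚ ℚ⟮η⟯ := adjoin.finiteDimensional hηint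
  have hfin₂ : FiniteDimensional ℚ⟮η⟯ ℚ⟮η⟯⟮ω⟯ := adjoin.finiteDimensional hωint
  have hfin₃ : FiniteDimensional ℚ ℚ⟮η⟯⟮ω⟯ := Module.Finite.trans ℚ⟮η⟯ _
  have hdegη : Module.finrank ℚ ℚ⟮η⟯ = r.totient := by
    rw [adjoin.finrank hηint, ← cyclotomic_eq_minpoly_rat hη hr, natDegree_cyclotomic]
  have hdegω := adjoin.finrank hωint
  have hle := minpoly.natDegree_le (A := ℚ) (⟨ζ, hmem⟩ : ℚ⟮η⟯⟮ω⟯)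
  rw [← minpoly.algebraMap_eq (B := ℚ⟮η⟯⟮ω⟯) (B' := ℂ) Subtype.val_injective] at hle
  change (minpoly ℚ ζ).natDegree ≤ _ at hle
  rwa [← cyclotomic_eq_minpoly_rat hζ hq, natDegree_cyclotomic,
    ← Module.finrank_mul_finrank ℚ ℚ⟮η⟯ ℚ⟮η⟯⟮ω⟯, hdegη, hdegω] at hle

theorem eq_zero_of_sum_pow_mul_eq_zero {K : IntermediateField ℚ ℂ} {ω : ℂ} {d : ℕ}
    (hd : d ≤ (minpoly K ω).natDegree) {v : ℕ → ℂ} (hv : ∀ j, v j ∈ K)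
    (hsum : ∑ j ∈ range d, ω ^ j * v j = 0) {j : ℕ} (hj : j < d) : v j = 0 := by
  set f : K[X] := ∑ j ∈ range d, monomial j (⟨v j, hv j⟩ : K) with hf
  have hcoeff (j : ℕ) (hj : j < d) : f.coeff j = ⟨v j, hv j⟩ := by
    simp [hf, coeff_monomial, hj]
  have hroot : aeval ω f = 0 := by
    rw [hf, map_sum, ← hsum]
    refine sum_congr rfl fun j _ => ?_
    rw [aeval_monomial, mul_comm]
    rfl
  have hf0 : f = 0 := by
    by_contra hne
    have hlt : f.degree < d := by
      rw [degree_lt_iff_coeff_zero]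
      intro m hm
      simp [hf, coeff_monomial, hm]
    have := (natDegree_lt_iff_degree_lt hne).2 hlt
    have := natDegree_le_of_degree_le ((minpoly.degree_le_of_ne_zero K ω hne hroot).trans
      degree_le_natDegree)
    omega
  have := hcoeff j hj
  rw [hf0, coeff_zero] at this
  exact (congrArg Subtype.val this).symm

/-- If `p ∣ r`, then the powers `ζ ^ j` with `j < p` of a primitive `p r`-th root of unity are
linearly independent over `ℚ(η)`. -/
theorem eq_zero_of_sum_eq_zero_of_dvd {p r : ℕ} (hp : p.Prime) (hr : 0 < r) (hpr : p ∣ r)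
    {η ζ : ℂ} (hη : IsPrimitiveRoot η r) (hζ : IsPrimitiveRoot ζ (p * r)) {v : ℕ → ℂ}
    (hv : ∀ j, v j ∈ ℚ⟮η⟯) (hsum : ∑ j ∈ range p, ζ ^ j * v j = 0) {j : ℕ} (hj : j < p) :
    v j = 0 := by
  have hpos : 0 < p * r := Nat.mul_pos hp.pos hr
  refine eq_zero_of_sum_pow_mul_eq_zero ?_ hv hsum hj
  have := totient_le_totient_mul_natDegree_minpoly hpos hr hη hζ (hζ.isIntegral hpos).tower_top
    (mem_adjoin_simple_self _ ζ)
  rw [Nat.totient_mul_of_prime_of_dvd hp hpr, mul_comm] at this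
  exact Nat.le_of_mul_le_mul_left this (Nat.totient_pos.2 hr)

/-- If `p ∤ r`, then `∑ ω ^ j = 0` is the only linear relation over `ℚ(η)` between the `p`-th
roots of unity. -/
theorem eq_of_sum_eq_zero_of_not_dvd {p r : ℕ} (hp : p.Prime) (hr : 0 < r) (hpr : ¬ p ∣ r)
    {η ω : ℂ} (hη : IsPrimitiveRoot η r) (hω : IsPrimitiveRoot ω p) {v : ℕ → ℂ}
    (hv : ∀ j, v j ∈ ℚ⟮η⟯) (hsum : ∑ j ∈ range p, ω ^ j * v j = 0) {i j : ℕ} (hi : i < p)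
    (hj : j < p) : v i = v j := by
  have hpos : 0 < p * r := Nat.mul_pos hp.pos hr
  have hcop : p.Coprime r := (Nat.Prime.coprime_iff_not_dvd hp).2 hpr
  have hprim : IsPrimitiveRoot (ω * η) (p * r) := by
    rw [IsPrimitiveRoot.iff_orderOf, (Commute.all ω η).orderOf_mul_eq_mul_orderOf_of_coprime]
    · rw [← hω.eq_orderOf, ← hη.eq_orderOf]
    · rwa [← hω.eq_orderOf, ← hη.eq_orderOf]
  have hmem : ω * η ∈ ℚ⟮η⟯⟮ω⟯ := mul_mem (mem_adjoin_simple_self _ ω)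
    ((ℚ⟮η⟯⟮ω⟯).algebraMap_mem ⟨η, mem_adjoin_simple_self ℚ η⟩)
  have hdeg := totient_le_totient_mul_natDegree_minpoly hpos hr hη hprim
    (hω.isIntegral hp.pos).tower_top hmem
  rw [Nat.totient_mul hcop, Nat.totient_prime hp, mul_comm] at hdeg
  have hdeg' := Nat.le_of_mul_le_mul_left hdeg (Nat.totient_pos.2 hr)
  obtain ⟨d, rfl⟩ : ∃ d, p = d + 1 := ⟨p - 1, by have := hp.pos; omega⟩
  have hgeom : ∑ j ∈ range (d + 1), ω ^ j = 0 := hω.geom_sum_eq_zero hp.one_lt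
  have hsum' : ∑ j ∈ range d, ω ^ j * (v j - v d) = 0 := by
    rw [sum_range_succ] at hsum hgeom
    simp only [mul_sub, sum_sub_distrib, ← sum_mul]
    linear_combination hsum - v d * hgeom
  have hlast (j : ℕ) (hj : j < d + 1) : v j = v d := by
    rcases (Nat.lt_succ_iff.1 hj).eq_or_lt with rfl | hlt
    · rfl
    · exact sub_eq_zero.1 (eq_zero_of_sum_pow_mul_eq_zero hdeg'
        (fun j => sub_mem (hv j) (hv d)) hsum' hlt)
  rw [hlast i hi, hlast j hj]

theorem multiset_sum_mem_adjoin {r : ℕ} (hr : 0 < r) {η : ℂ} (hη : IsPrimitiveRoot η r)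
    {X : Multiset ℂ} (hX : ∀ z ∈ X, z ^ r = 1) : X.sum ∈ ℚ⟮η⟯ := by
  have : NeZero r := ⟨hr.ne'⟩
  refine multiset_sum_mem _ fun z hz => ?_
  obtain ⟨i, -, rfl⟩ := hη.eq_pow_of_pow_eq_one (hX z hz)
  exact pow_mem (mem_adjoin_simple_self ℚ η) i

end Cyclotomic

/-! ### Coset decompositions and sums with few terms -/

section Cosets

/-- A multiset of `q`-th roots of unity is split along the cosets of the `r`-th roots of unity,
provided that the powers `ω ^ j` with `j < p` represent all cosets. -/
theorem exists_coset_parts {p q r : ℕ} {ω : ℂ}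
    (hω : ∀ z : ℂ, z ^ q = 1 → ∃ j < p, ∃ h : ℂ, h ^ r = 1 ∧ z = ω ^ j * h) (X : Multiset ℂ)
    (hX : ∀ z ∈ X, z ^ q = 1) :
    ∃ Y : ℕ → Multiset ℂ, (∀ j, ∀ z ∈ Y j, z ^ r = 1) ∧
      X = ∑ j ∈ range p, (Y j).map (ω ^ j * ·) := by
  induction X using Multiset.induction_on with
  | empty => exact ⟨fun _ => 0, by simp, by simp⟩
  | cons a X ih =>
    obtain ⟨Y, hY, hXY⟩ := ih fun z hz => hX z (Multiset.mem_cons_of_mem hz)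
    obtain ⟨i, hi, h, hh, rfl⟩ := hω a (hX a (Multiset.mem_cons_self a X))
    refine ⟨fun j => (if j = i then {h} else 0) + Y j, fun j z hz => ?_, ?_⟩
    · rcases Multiset.mem_add.1 hz with hz | hz
      · split_ifs at hz with hji
        · rwa [Multiset.mem_singleton.1 hz]
        · simp at hz
      · exact hY j z hz
    · simp only [Multiset.map_add, sum_add_distrib]
      rw [← hXY, ← Multiset.singleton_add]
      congr 1
      rw [sum_eq_single i]
      · simp
      · intro j _ hji
        simp [hji]
      · intro hi'
        exact absurd (mem_range.2 hi) hi'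

theorem sum_coset_parts {p : ℕ} {ω : ℂ} (Y : ℕ → Multiset ℂ) :
    (∑ j ∈ range p, (Y j).map (ω ^ j * ·)).sum = ∑ j ∈ range p, ω ^ j * (Y j).sum := by
  rw [← Multiset.coe_sumAddMonoidHom, map_sum]
  refine sum_congr rfl fun j _ => ?_
  simpa using Multiset.sum_map_mul_left (s := Y j) (a := ω ^ j) (f := id)

theorem card_coset_parts {p : ℕ} {ω : ℂ} (Y : ℕ → Multiset ℂ) :
    (∑ j ∈ range p, (Y j).map (ω ^ j * ·)).card = ∑ j ∈ range p, (Y j).card := by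
  simp [Multiset.card_sum]

theorem exists_eq_pow_mul_of_isPrimitiveRoot {p r : ℕ} (hp : 0 < p) (hr : 0 < r) {ζ : ℂ}
    (hζ : IsPrimitiveRoot ζ (p * r)) {z : ℂ} (hz : z ^ (p * r) = 1) :
    ∃ j < p, ∃ h : ℂ, h ^ r = 1 ∧ z = ζ ^ j * h := by
  have : NeZero (p * r) := ⟨(Nat.mul_pos hp hr).ne'⟩
  obtain ⟨i, -, rfl⟩ := hζ.eq_pow_of_pow_eq_one hz
  refine ⟨i % p, Nat.mod_lt i hp, ζ ^ (p * (i / p)), ?_, ?_⟩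
  · rw [← pow_mul, mul_right_comm, pow_mul, hζ.pow_eq_one, one_pow]
  · rw [← pow_add, Nat.mod_add_div]

theorem exists_eq_pow_mul_of_coprime {p r : ℕ} (hp : 1 < p) (hpr : r.Coprime p)
    {ω : ℂ} (hω : IsPrimitiveRoot ω p) {z : ℂ} (hz : z ^ (p * r) = 1) :
    ∃ j < p, ∃ h : ℂ, h ^ r = 1 ∧ z = ω ^ j * h := by
  have : NeZero p := ⟨by omega⟩
  have hz0 : z ≠ 0 := by
    rintro rfl
    rcases Nat.eq_zero_or_pos r with rfl | hr
    · simp at hpr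
      omega
    · rw [zero_pow (Nat.mul_pos (by omega) hr).ne'] at hz
      exact zero_ne_one hz
  obtain ⟨s, hs⟩ := Nat.exists_mul_mod_eq_one_of_coprime hpr hp
  obtain ⟨j, hj, hjz⟩ := hω.eq_pow_of_pow_eq_one (ξ := z ^ (r * s)) (by
    rw [← pow_mul, show r * s * p = p * r * s by ring, pow_mul, hz, one_pow])
  have hrs : r * s = 1 + p * (r * s / p) := by
    rw [← hs.2]
    exact (Nat.mod_add_div _ _).symm
  refine ⟨j, hj, z * (z ^ (r * s))⁻¹, ?_, ?_⟩
  · have : z ^ (r * s * r) = z ^ r := by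
      rw [hrs, add_mul, one_mul, pow_add, show p * (r * s / p) * r = p * r * (r * s / p) by ring,
        pow_mul z (p * r), hz, one_pow, mul_one]
    rw [mul_pow, inv_pow, ← pow_mul, this, mul_inv_cancel₀ (pow_ne_zero r hz0)]
  · rw [hjz]
    field_simp

/-- If two multisets of `p r`-th roots of unity, where `p ∤ r`, have the same sum, then all the
differences between the sums of corresponding coset parts coincide. -/
theorem sum_parts_sub_eq {p r : ℕ} (hp : p.Prime) (hr : 0 < r) (hpr : ¬ p ∣ r) {ω : ℂ}
    (hω : IsPrimitiveRoot ω p) {X Y : ℕ → Multiset ℂ} (hX : ∀ j, ∀ z ∈ X j, z ^ r = 1)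
    (hY : ∀ j, ∀ z ∈ Y j, z ^ r = 1)
    (hsum : (∑ j ∈ range p, (X j).map (ω ^ j * ·)).sum =
      (∑ j ∈ range p, (Y j).map (ω ^ j * ·)).sum) {i j : ℕ} (hi : i < p) (hj : j < p) :
    (X i).sum - (Y i).sum = (X j).sum - (Y j).sum := by
  have hη := Complex.isPrimitiveRoot_exp r hr.ne'
  refine eq_of_sum_eq_zero_of_not_dvd hp hr hpr hη hω
    (v := fun j => (X j).sum - (Y j).sum) (fun j => sub_mem
      (multiset_sum_mem_adjoin hr hη (hX j)) (multiset_sum_mem_adjoin hr hη (hY j))) ?_ hi hj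
  rw [sum_coset_parts, sum_coset_parts] at hsum
  simp only [mul_sub, sum_sub_distrib, hsum, sub_self]

theorem eq_of_sum_eq_of_forall_pow_one {X Y : Multiset ℂ} (hX : ∀ z ∈ X, z ^ 1 = 1)
    (hY : ∀ z ∈ Y, z ^ 1 = 1) (h : X.sum = Y.sum) : X = Y := by
  simp only [pow_one] at hX hY
  rw [Multiset.eq_replicate_card.2 hX, Multiset.eq_replicate_card.2 hY] at h ⊢
  simp only [Multiset.sum_replicate, nsmul_eq_mul, mul_one, Nat.cast_inj] at h
  rw [h]

end Cosets

section Comparison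

/-- The estimate in the inductive step of `le_or_sub_mul_le_card`. There `X` has `a` elements, `c` of
them in one coset part; `J` parts of `X` are empty, each of the corresponding parts of `Y` has at
least `s` elements, and one further part of `Y` has `w` elements. -/
theorem sub_mul_le_of_card_bounds {u₁ u₂ p a c s J w : ℕ} (hc : 1 ≤ c) (hca : c ≤ a)
    (hau : a < u₁) (hu : u₁ ≤ u₂) (hup : u₂ ≤ p) (hJ : p ≤ J + 1 + (a - c))
    (h : u₁ ≤ c + s ∨ (u₁ - (c + s)) * (u₂ - 1) ≤ w) :
    (u₁ - a) * (u₂ - 1) ≤ w + s * J := by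
  obtain ⟨c, rfl⟩ := Nat.exists_eq_add_of_le' hc
  obtain ⟨t, rfl⟩ := Nat.exists_eq_add_of_le hca
  obtain ⟨u, rfl⟩ := Nat.exists_eq_add_of_le hau.le
  obtain ⟨e, rfl⟩ := Nat.exists_eq_add_of_le hu
  obtain ⟨f, rfl⟩ := Nat.exists_eq_add_of_le hup
  have hJ' : c + u + e + f ≤ J := by omega
  have hsJ : s * (c + u + e) ≤ s * J := Nat.mul_le_mul_left s (by omega)
  have e₁ : c + 1 + t + u - (c + 1 + t) = u := by omega
  have e₂ : c + 1 + t + u + e - 1 = c + t + u + e := by omega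
  have e₃ : c + 1 + t + u - (c + 1 + s) = t + u - s := by omega
  rw [e₂, e₃] at h
  rw [e₁, e₂]
  rcases le_or_gt (t + u) s with hs | hs
  · have := Nat.mul_le_mul_right (c + u + e) hs
    nlinarith [Nat.zero_le (t * c), Nat.zero_le (t * e)]
  · have hw := h.resolve_left (by omega)
    rcases le_or_gt s t with hst | hst
    · have := Nat.mul_le_mul_right (c + t + u + e) (show u ≤ t + u - s by omega)
      omega
    · obtain ⟨d, rfl⟩ := Nat.exists_eq_add_of_le hst.le
      obtain ⟨g, rfl⟩ : ∃ g, u = d + g := ⟨u - d, by omega⟩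
      rw [show t + (d + g) - (t + d) = g by omega] at hw
      nlinarith [Nat.zero_le (t * c), Nat.zero_le (t * e), Nat.zero_le (t * g)]

/-- A short multiset `X` of roots of unity of squarefree order is contained in every multiset `Y`
with the same sum, unless `Y` is long. Here `u₁` is a lower bound for all prime divisors of the
order, and `u₂` for all of them but `p₀`. -/
theorem le_or_sub_mul_le_card {q : ℕ} (hq : Squarefree q) {u₁ u₂ p₀ : ℕ} (hu : u₁ ≤ u₂)
    (h₁ : ∀ p, p.Prime → p ∣ q → u₁ ≤ p) (h₂ : ∀ p, p.Prime → p ∣ q → p ≠ p₀ → u₂ ≤ p)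
    {X Y : Multiset ℂ} (hX : ∀ z ∈ X, z ^ q = 1) (hY : ∀ z ∈ Y, z ^ q = 1)
    (hsum : X.sum = Y.sum) (hcard : X.card < u₁) :
    X ≤ Y ∨ (u₁ - X.card) * (u₂ - 1) ≤ Y.card := by
  induction q using Nat.strong_induction_on generalizing X Y with
  | _ q ih =>
  have hq0 : 0 < q := Nat.pos_of_ne_zero hq.ne_zero
  rcases eq_or_ne q 1 with rfl | hq1
  · exact Or.inl (eq_of_sum_eq_of_forall_pow_one hX hY hsum).le
  -- A prime other than `p₀` is split off as long as there is one.
  obtain ⟨p, r, hp, rfl, hpu⟩ : ∃ p r, p.Prime ∧ q = p * r ∧ (u₂ ≤ p ∨ r = 1) := by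
    by_cases h : ∃ p, p.Prime ∧ p ∣ q ∧ p ≠ p₀
    · obtain ⟨p, hp, ⟨r, rfl⟩, hne⟩ := h
      exact ⟨p, r, hp, rfl, Or.inl (h₂ p hp (dvd_mul_right p r) hne)⟩
    · push Not at h
      obtain ⟨p, hp, r, rfl⟩ := Nat.exists_prime_and_dvd hq1
      refine ⟨p, r, hp, rfl, Or.inr ?_⟩
      by_contra hr
      obtain ⟨l, hl, hlr⟩ := Nat.exists_prime_and_dvd hr
      have hlp : l = p := (h l hl (hlr.mul_left p)).trans (h p hp (dvd_mul_right p r)).symm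
      subst hlp
      exact hl.not_isUnit (hq l (Nat.mul_dvd_mul_left l hlr))
  have hr : 0 < r := Nat.pos_of_mul_pos_left hq0
  have hpr : ¬ p ∣ r := fun h => hp.not_isUnit (hq p (Nat.mul_dvd_mul_left p h))
  have hω := Complex.isPrimitiveRoot_exp p hp.ne_zero
  set ω := Complex.exp (2 * Real.pi * Complex.I / p)
  have hcos (z : ℂ) (hz : z ^ (p * r) = 1) := exists_eq_pow_mul_of_coprime hp.one_lt
    ((Nat.Prime.coprime_iff_not_dvd hp).2 hpr).symm hω hz
  obtain ⟨X, hXr, rfl⟩ := exists_coset_parts hcos X hX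
  obtain ⟨Y, hYr, rfl⟩ := exists_coset_parts hcos Y hY
  have hdiff {i j : ℕ} (hi : i < p) (hj : j < p) :=
    sum_parts_sub_eq hp hr hpr hω hXr hYr hsum hi hj
  rw [card_coset_parts] at hcard ⊢
  rw [card_coset_parts]
  have hu₁p := h₁ p hp (dvd_mul_right p r)
  set J := {j ∈ range p | X j = 0} with hJdef
  set T := {j ∈ range p | X j ≠ 0} with hTdef
  have hJT : #J + #T = p := by
    simpa using card_filter_add_card_filter_not (s := range p) fun j => X j = 0
  have hTpos (j : ℕ) (hj : j ∈ T) : 1 ≤ (X j).card :=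
    Multiset.card_pos.2 (mem_filter.1 hj).2
  have hTsum (T' : Finset ℕ) (hT' : T' ⊆ T) : #T' ≤ ∑ j ∈ T', (X j).card := by
    rw [card_eq_sum_ones]
    exact sum_le_sum fun j hj => hTpos j (hT' hj)
  have hsub : ∑ j ∈ T, (X j).card ≤ ∑ j ∈ range p, (X j).card :=
    sum_le_sum_of_subset (filter_subset _ _)
  have hJne : J.Nonempty := by
    rw [← card_pos]
    have := hTsum T subset_rfl
    omega
  -- Since `X j₀ = 0`, each `X i + Y j₀` has the same sum as `Y i`, and induction applies if it is
  -- short. If it is long, then so is `Y j₀`, hence all of the many parts `Y j` with `j ∈ J`.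
  obtain ⟨j₀, hj₀, hmin⟩ := exists_min_image J (fun j => (Y j).card) hJne
  have hj₀' := mem_filter.1 hj₀
  by_cases hall : ∀ i ∈ range p, X i ≤ Y i
  · exact Or.inl (sum_le_sum fun i hi => Multiset.map_le_map (hall i hi))
  refine Or.inr ?_
  push Not at hall
  obtain ⟨i, hi, hnot⟩ := hall
  have hiT : i ∈ T := by
    refine mem_filter.2 ⟨hi, fun h0 => hnot ?_⟩
    rw [h0]
    exact Multiset.zero_le _
  have hiJ : i ∉ J := fun h => (mem_filter.1 hiT).2 (mem_filter.1 h).2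
  have hsumi : (X i + Y j₀).sum = (Y i).sum := by
    have := hdiff (mem_range.1 hi) (mem_range.1 hj₀'.1)
    rw [hj₀'.2, Multiset.sum_zero] at this
    rw [Multiset.sum_add]
    linear_combination this
  have hnot' : ¬ X i + Y j₀ ≤ Y i := fun h => hnot ((Multiset.le_add_right _ _).trans h)
  have hroots : ∀ z ∈ X i + Y j₀, z ^ r = 1 := fun z hz =>
    (Multiset.mem_add.1 hz).elim (hXr i z) (hYr j₀ z)
  have hr1 : r ≠ 1 := by
    rintro rfl
    exact hnot' (eq_of_sum_eq_of_forall_pow_one hroots (hYr i) hsumi).le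
  have hw : u₁ ≤ (X i).card + (Y j₀).card ∨
      (u₁ - ((X i).card + (Y j₀).card)) * (u₂ - 1) ≤ (Y i).card := by
    rcases le_or_gt u₁ ((X i).card + (Y j₀).card) with h | h
    · exact Or.inl h
    · have := ih r (lt_mul_of_one_lt_left hr hp.one_lt) (hq.squarefree_of_dvd (dvd_mul_left r p))
        (fun l hl hlr => h₁ l hl (hlr.mul_left p)) (fun l hl hlr => h₂ l hl (hlr.mul_left p))
        hroots (hYr i) hsumi (by rwa [Multiset.card_add])
      rw [Multiset.card_add] at this
      exact Or.inr (this.resolve_left hnot')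
  have hTi := add_sum_erase T (fun j => (X j).card) hiT
  have hTi' := hTsum (T.erase i) (erase_subset i T)
  have hTcard := card_erase_add_one hiT
  have hlow : (Y i).card + (Y j₀).card * #J ≤ ∑ j ∈ range p, (Y j).card := by
    have h1 : ∑ j ∈ insert i J, (Y j).card ≤ ∑ j ∈ range p, (Y j).card :=
      sum_le_sum_of_subset (insert_subset hi (filter_subset _ _))
    rw [sum_insert hiJ] at h1
    have h2 := card_nsmul_le_sum J (fun j => (Y j).card) _ hmin
    rw [smul_eq_mul, mul_comm] at h2
    omega
  exact (sub_mul_le_of_card_bounds (hTpos i hiT) (by omega) hcard hu (hpu.resolve_right hr1)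
    (by omega) hw).trans hlow

end Comparison

/-! ### Vanishing sums of roots of unity -/

section LamLeung

theorem zero_mem_D (q : ℕ) : 0 ∈ D q := ⟨fun _ => 0, by simp⟩

theorem add_mem_D {q s t : ℕ} (hs : s ∈ D q) (ht : t ∈ D q) : s + t ∈ D q := by
  obtain ⟨x, rfl⟩ := hs
  obtain ⟨y, rfl⟩ := ht
  exact ⟨fun p => x p + y p, by simp [mul_add, sum_add_distrib]⟩

theorem sum_mem_D {q : ℕ} {ι : Type*} (s : Finset ι) {f : ι → ℕ} (h : ∀ i ∈ s, f i ∈ D q) :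
    ∑ i ∈ s, f i ∈ D q :=
  sum_induction f (· ∈ D q) (fun _ _ => add_mem_D) (zero_mem_D q) h

theorem prime_mul_mem_D {p q : ℕ} (hq : q ≠ 0) (hp : p.Prime) (hpq : p ∣ q) (c : ℕ) :
    p * c ∈ D q := by
  refine ⟨fun l => if l = p then c else 0, ?_⟩
  simp [hp, hpq, hq]

theorem D_subset_D {q r : ℕ} (hq : q ≠ 0) (hrq : r ∣ q) : D r ⊆ D q := by
  rintro s ⟨x, rfl⟩
  exact sum_mem_D _ fun p hp => prime_mul_mem_D hq (Nat.prime_of_mem_primeFactors hp)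
    ((Nat.dvd_of_mem_primeFactors hp).trans hrq) _

/-- The **Lam–Leung theorem**: the number of terms in a vanishing sum of `q`-th roots of unity is
a sum of prime divisors of `q`. -/
theorem card_mem_D_of_sum_eq_zero {q : ℕ} (hq : 0 < q) {X : Multiset ℂ}
    (hX : ∀ z ∈ X, z ^ q = 1) (hsum : X.sum = 0) : X.card ∈ D q := by
  induction q using Nat.strong_induction_on generalizing X with
  | _ q ih =>
  by_cases hsq : Squarefree q
  swap
  · -- If `p ^ 2 ∣ q`, all coset parts vanish separately.
    rw [Nat.squarefree_iff_prime_squarefree] at hsq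
    push Not at hsq
    obtain ⟨p, hp, hpq⟩ := hsq
    obtain ⟨r, rfl⟩ := (dvd_mul_right p p).trans hpq
    have hr : 0 < r := Nat.pos_of_mul_pos_left hq
    have hpr : p ∣ r := Nat.dvd_of_mul_dvd_mul_left hp.pos hpq
    have hζ := Complex.isPrimitiveRoot_exp (p * r) hq.ne'
    have hη := Complex.isPrimitiveRoot_exp r hr.ne'
    obtain ⟨Y, hY, rfl⟩ := exists_coset_parts
      (fun z hz => exists_eq_pow_mul_of_isPrimitiveRoot hp.pos hr hζ hz) X hX
    rw [sum_coset_parts] at hsum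
    rw [card_coset_parts]
    exact sum_mem_D _ fun j hj => D_subset_D hq.ne' (dvd_mul_left r p)
      (ih r (lt_mul_of_one_lt_left hr hp.one_lt) hr (hY j)
        (eq_zero_of_sum_eq_zero_of_dvd hp hr hpr hη hζ
          (fun j => multiset_sum_mem_adjoin hr hη (hY j)) hsum (mem_range.1 hj)))
  rcases eq_or_ne q 1 with rfl | hq1
  · rw [eq_of_sum_eq_of_forall_pow_one hX (Y := 0) (by simp) (by simpa using hsum)]
    exact zero_mem_D 1
  -- The index `p` of the cosets is the second smallest prime divisor of `q`, or `q` if `q` is prime.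
  have hp₁ := Nat.minFac_prime hq1
  obtain ⟨p, r, hp, rfl, hpr⟩ : ∃ p r, p.Prime ∧ q = p * r ∧
      (r = 1 ∨ ((p * r).minFac ∣ r ∧ (p * r).minFac < p ∧
        ∀ l, l.Prime → l ∣ r → l ≠ (p * r).minFac → p ≤ l)) := by
    obtain ⟨t, ht⟩ := Nat.minFac_dvd q
    rcases eq_or_ne t 1 with rfl | ht1
    · exact ⟨q.minFac, 1, hp₁, ht, Or.inl rfl⟩
    · obtain ⟨r, hr⟩ := Nat.minFac_dvd t
      have hp₂ := Nat.minFac_prime ht1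
      have hqr : q = t.minFac * (q.minFac * r) := by
        rw [mul_left_comm, ← hr]
        exact ht
      refine ⟨t.minFac, q.minFac * r, hp₂, hqr, Or.inr ?_⟩
      rw [← hqr]
      refine ⟨dvd_mul_right _ _, lt_of_le_of_ne (Nat.minFac_le_of_dvd hp₂.two_le
        ⟨_, hqr⟩) fun h => ?_, fun l hl hlr hne => ?_⟩
      · refine hp₁.not_isUnit (hsq q.minFac ⟨r, ?_⟩)
        rw [mul_assoc]
        nth_rw 2 [h]
        rw [← hr]
        exact ht
      · have hlr' : l ∣ r := ((Nat.Prime.dvd_mul hl).1 hlr).resolve_left fun h =>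
          hne ((Nat.prime_dvd_prime_iff_eq hl hp₁).1 h)
        exact Nat.minFac_le_of_dvd hl.two_le (hlr'.trans ⟨t.minFac, by rw [mul_comm]; exact hr⟩)
  have hr : 0 < r := Nat.pos_of_mul_pos_left hq
  have hndvd : ¬ p ∣ r := fun h => hp.not_isUnit (hsq p (Nat.mul_dvd_mul_left p h))
  have hω := Complex.isPrimitiveRoot_exp p hp.ne_zero
  set ω := Complex.exp (2 * Real.pi * Complex.I / p)
  obtain ⟨Y, hY, rfl⟩ := exists_coset_parts (fun z hz => exists_eq_pow_mul_of_coprime hp.one_lt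
    ((Nat.Prime.coprime_iff_not_dvd hp).2 hndvd).symm hω hz) X hX
  have heq {i j : ℕ} (hi : i < p) (hj : j < p) : (Y i).sum = (Y j).sum := by
    simpa using sum_parts_sub_eq hp hr hndvd hω hY (Y := fun _ => 0) (by simp)
      (by simpa using hsum) hi hj
  rw [card_coset_parts]
  obtain ⟨i, hi, hmin⟩ := exists_min_image (range p) (fun j => (Y j).card)
    ⟨0, mem_range.2 hp.pos⟩
  by_cases hall : ∀ j ∈ range p, Y i ≤ Y j
  · have hsplit : ∑ j ∈ range p, (Y j).card =
        p * (Y i).card + ∑ j ∈ range p, (Y j - Y i).card := by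
      have hconst : ∑ _j ∈ range p, (Y i).card = p * (Y i).card := by simp
      rw [← hconst, ← sum_add_distrib]
      refine sum_congr rfl fun j hj => ?_
      rw [← Multiset.card_add, add_tsub_cancel_of_le (hall j hj)]
    rw [hsplit]
    refine add_mem_D (prime_mul_mem_D hq.ne' hp (dvd_mul_right p r) _) (sum_mem_D _ fun j hj =>
      D_subset_D hq.ne' (dvd_mul_left r p) (ih r (lt_mul_of_one_lt_left hr hp.one_lt) hr
        (fun z hz => hY j z (Multiset.mem_of_le tsub_le_self hz)) ?_))
    have hadd := congrArg Multiset.sum (add_tsub_cancel_of_le (hall j hj))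
    rw [Multiset.sum_add, heq (mem_range.1 hi) (mem_range.1 hj)] at hadd
    exact left_eq_add.1 hadd.symm
  push Not at hall
  obtain ⟨j, hj, hnot⟩ := hall
  have hsumij := heq (mem_range.1 hi) (mem_range.1 hj)
  obtain ⟨hdvd, hlt, hlarge⟩ := hpr.resolve_left (by
    rintro rfl
    exact hnot (eq_of_sum_eq_of_forall_pow_one (hY i) (hY j) hsumij).le)
  set p₁ := (p * r).minFac
  -- Otherwise there are at least `(p₁ - 1) (p - 1)` terms, and Sylvester's theorem applies.
  have hlow : (p₁ - 1) * (p - 1) ≤ ∑ j ∈ range p, (Y j).card := by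
    have hp1 := hp.one_lt
    rcases le_or_gt p₁ (Y i).card with h | h
    · have h2 := card_nsmul_le_sum (range p) (fun j => (Y j).card) _ hmin
      rw [card_range, smul_eq_mul] at h2
      refine le_trans ?_ h2
      rw [mul_comm]
      exact Nat.mul_le_mul (by omega) (by omega)
    · have hbound := (le_or_sub_mul_le_card (hsq.squarefree_of_dvd (dvd_mul_left r p)) hlt.le
        (fun l hl hlr => Nat.minFac_le_of_dvd hl.two_le (hlr.mul_left p)) hlarge (hY i) (hY j)
        hsumij h).resolve_left hnot
      have h2 := card_nsmul_le_sum ((range p).erase j) (fun j => (Y j).card) _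
        fun l hl => hmin l (mem_of_mem_erase hl)
      rw [card_erase_of_mem hj, card_range, smul_eq_mul] at h2
      rw [← add_sum_erase _ _ hj]
      refine le_trans ?_ (Nat.add_le_add hbound h2)
      rw [mul_comm (p - 1), ← add_mul, Nat.sub_add_cancel h.le]
      exact Nat.mul_le_mul_right _ (Nat.sub_le _ _)
  obtain ⟨a, b, hab⟩ := Nat.exists_add_mul_eq_of_gcd_dvd_of_mul_pred_le p₁ p _ (by
    rw [(Nat.coprime_primes hp₁ hp).2 hlt.ne]
    exact one_dvd _) hlow
  rw [← hab, mul_comm a, mul_comm b]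
  exact add_mem_D (prime_mul_mem_D hq.ne' hp₁ (hdvd.mul_left p) a)
    (prime_mul_mem_D hq.ne' hp (dvd_mul_right p r) b)

theorem permanent_B_ne_zero {n q : ℕ} {b : Fin n → ℂ} (hq : 0 < q) (hb : ∀ i, b i ^ q = 1)
    (hn : n.factorial ∉ D q) : (B b).permanent ≠ 0 := by
  intro h0
  refine hn ?_
  have h := card_mem_D_of_sum_eq_zero hq
    (X := (univ : Finset (Equiv.Perm (Fin n))).val.map fun σ : Equiv.Perm (Fin n) => ∏ i, B b (σ i) i) ?_ h0
  · simpa [Fintype.card_perm] using h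
  · intro z hz
    obtain ⟨σ, -, rfl⟩ := Multiset.mem_map.1 hz
    rw [← prod_pow]
    refine prod_eq_one fun i _ => ?_
    rw [B, Matrix.of_apply, ← pow_mul, mul_comm, pow_mul, hb, one_pow]

end LamLeung

end RestrictedSumset


theorem theorem1p2 (k m n : ℕ) (hk : 0 < k) (hm : 0 < m) (hn : 0 < n) (hkmn : m * (n - 1) < k) :
    (∀ (F : Type*) [Field F] (A : Fin n → Finset F) (P : Fin n → Polynomial F),
      (∀ i, (A i).card = k) → (∀ i, (P i).degree = (m : WithBot ℕ)) →
        -- part (i)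
        (((RestrictedSumset.K k m n : ℕ∞) < RestrictedSumset.ch F →
          (∀ i j, i ≠ j → (P i).coeff m ≠ (P j).coeff m) →
          RestrictedSumset.K k m n + 1 ≤ (RestrictedSumset.S A P).ncard) ∧
        -- part (ii)
        ((RestrictedSumset.K' k m n : ℕ∞) < RestrictedSumset.ch F →
          (RestrictedSumset.B fun i => (P i).coeff m).permanent ≠ 0 →
          RestrictedSumset.K' k m n + 1 ≤ (RestrictedSumset.T A P).ncard))) ∧
    -- part (iii)
    (∀ (b : Fin n → ℂ) (q : ℕ), 0 < q → (∀ i, b i ^ q = 1) →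
      n.factorial ∉ RestrictedSumset.D q → (RestrictedSumset.B b).permanent ≠ 0) :=
  ⟨fun _ _ _ _ hA hP =>
    ⟨fun hch hb => RestrictedSumset.succ_K_le_ncard_S hk hkmn hA hP hch hb,
      fun hch hB => RestrictedSumset.succ_K'_le_ncard_T hk hm hn hkmn hA hP hch hB⟩,
    fun _ _ hq hb hnD => RestrictedSumset.permanent_B_ne_zero hq hb hnD⟩
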